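/- A minimax integer program (MIP) has variables $W\in\mathbb{R}$ and $x_{i,j}$ ($1\le i\le n$, $1\le j\le \ell_i$, with all $\ell_i\ge 1$), and asks to minimize $W$ subject to $\sum_{j} x_{i,j}=1$ for every $i$, $Ax\le (W,\dots,W)^T$, and $x_{i,j}\in\{0,1\}$, where $A\in[0,1]^{m\times N}$, $m\ge 1$, $N=\sum_i \ell_i$. Let $a$ be the maximum number of nonzero entries in a column of $A$, and let $y^*$ be the optimal value of the LP relaxation (where $x_{i,j}\in\{0,1\}$ is replaced by $x_{i,j}\in[0,1]$). For $\mu>0$ and $0<p\le 1$ let, with logarithms to base $2$, $$H(\mu,p)=\frac{\log(p^{-1})}{\mu\,\log(\log(p^{-1})/\mu)}\ \text{ if } \mu\le \tfrac12\log(p^{-1}),\qquad H(\mu,p)=\sqrt{\frac{\log(\mu+p^{-1})}{\mu}}\ \text{ otherwise,}$$ and read $\mu\,H(\mu,p)$ as $0$ when $\mu=0$. (1) There is an absolute constant $C>0$ such that every MIP has an integral solution of value at most $$y^*+C+C\cdot\min\{y^*,m\}\cdot H(\min\{y^*,m\},1/a).$$ (2) There is an absolute constant $C>0$ such that for every set system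 $D_1,\dots,D_M\subseteq[n]$ with $\Delta=\max_{i\in[n]}|\{j: i\in D_j\}|$ and $\Delta'=\max_j|D_j|$ (maxima over empty sets being $0$), and every positive integer $\ell$, with $y^*=\Delta'/\ell$, there is $f:[n]\to[\ell]$ such that for all $j\in[M]$ and $k\in[\ell]$, $$|\{i\in D_j : f(i)=k\}|\le y^*\bigl(1+C\,H(y^*,1/\Delta)\bigr)+C.$$ -/

import Mathlib

/-- The data of a minimax integer program with `n` groups of variables
`x ⟨i, j⟩`, `j ∈ Fin (ℓ i)`, and `m` inequality constraints `A x ≤ W`,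
the entries of `A` being in `[0, 1]`. -/
structure MinimaxIP (m n : ℕ) where
  /-- group sizes -/
  ℓ : Fin n → ℕ
  /-- constraint matrix, its columns indexed by the pairs `(i, j)` -/
  A : Matrix (Fin m) ((i : Fin n) × Fin (ℓ i)) ℝ
  A_mem : ∀ r c, A r c ∈ Set.Icc (0 : ℝ) 1

namespace MinimaxIP

variable {m n : ℕ} (P : MinimaxIP m n)

/-- The equality constraints and the system of inequalities, without any range constraint
on the variables. -/
def SatisfiesConstraints (x : ((i : Fin n) × Fin (P.ℓ i)) → ℝ) (W : ℝ) : Prop :=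
  (∀ i, ∑ j, x ⟨i, j⟩ = 1) ∧ ∀ r, (P.A.mulVec x) r ≤ W

/-- `(x, W)` is feasible for the integer program. -/
def IsIntegralSolution (x : ((i : Fin n) × Fin (P.ℓ i)) → ℝ) (W : ℝ) : Prop :=
  (∀ c, x c = 0 ∨ x c = 1) ∧ P.SatisfiesConstraints x W

/-- `(x, W)` is feasible for the linear programming relaxation. -/
def IsFractionalSolution (x : ((i : Fin n) × Fin (P.ℓ i)) → ℝ) (W : ℝ) : Prop :=
  (∀ c, x c ∈ Set.Icc (0 : ℝ) 1) ∧ P.SatisfiesConstraints x W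

/-- The optimal value `y*` of the linear programming relaxation. The set is nonempty when
every group is nonempty, and bounded below (by `0`) when `0 < m`. -/
noncomputable def lpValue : ℝ :=
  sInf {W : ℝ | ∃ x, P.IsFractionalSolution x W}

open Classical in
/-- The column sparsity `a`: the maximum number of nonzero entries in a column of `A`. -/
noncomputable def columnSparsity : ℕ :=
  Finset.univ.sup fun c => (Finset.univ.filter fun r => P.A r c ≠ 0).card

end MinimaxIP

/-- The large-deviation function `H(μ, p)`, for `μ > 0` and `0 < p ≤ 1`. With
`G(μ, δ) = (e^δ / (1 + δ)^(1 + δ))^μ` the Chernoff bound, `H(μ, p)` stands for a `δ > 0` with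
`⌈μ δ⌉ * G(μ, δ) ≤ p`, and is specified up to absolute constant factors (which is all that
matters in `O(μ * H(μ, p))`) by the following two-case formula. Logarithms are to base `2`. -/
noncomputable def devH (μ p : ℝ) : ℝ :=
  if μ ≤ Real.logb 2 p⁻¹ / 2 then
    Real.logb 2 p⁻¹ / (μ * Real.logb 2 (Real.logb 2 p⁻¹ / μ))
  else
    Real.sqrt (Real.logb 2 (μ + p⁻¹) / μ)

/-- The degree `Δ` of a set system: the maximum number of sets containing a point. -/
def setSystemDegree {n M : ℕ} (D : Fin M → Finset (Fin n)) : ℕ :=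
  Finset.univ.sup fun i => (Finset.univ.filter fun j => i ∈ D j).card

/-- The maximum size `Δ'` of a set of a set system. -/
def setSystemMaxSize {n M : ℕ} (D : Fin M → Finset (Fin n)) : ℕ :=
  Finset.univ.sup fun j => (D j).card

/-! Round at random: each group `i` independently picks one `j`, with probability `x_{i,j}`
(uniformly for colourings). A union bound over all rows would cost `log m`; to pay only `log a`,
coordinates are added one at a time. Let `E_U` be the event that every row sum over the coordinates
in `U` is at most the full row mean plus `D`. When `i ∉ U` is added with value `j`, only the at most
`a` rows with a nonzero entry in column `(i, j)` can fail, and such a row must already exceed its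
threshold minus 1. If, given `E_U`, each row does so with probability at most `q`, then `P(E_U) ≤ β
P(E_{U ∪ i})` as soon as `β (1 - a q) ≥ 1`, and in the end `E` has positive probability for the full
set.

The Chernoff bound is needed conditionally on `E_U`, and the induction supplies it. For `φ_i ≥ 1`
write `φ_i = 1 + (φ_i - 1)`; in the second term relax `E_U` to `E_{U \ i}`, which is independent of
coordinate `i` and at most `β` times as likely. Conditioning thus only replaces `1 + E(φ_i - 1)` by
`1 + β E(φ_i - 1)` (`prodExpect_goodInd_mul_prod_le`, `prodExpect_goodInd_le_insert`). Tuning the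
parameters makes `D` of order `1 + μ H(μ, 1/a)` (`exists_rounding_parameters`).

The minimum with `m` comes from a sparse optimal LP solution with at most `m` fractional groups:
only these are rounded, and their row means are at most `m`. Colourings need no LP. -/

/-! ### Expectation under a finite product measure -/

section ProductExpectation

variable {ι : Type*} [Fintype ι] [DecidableEq ι] {κ : ι → Type*} [∀ i, Fintype (κ i)]

/-- The expectation of `F` under the product of the weights `p i` on the types `κ i`. -/
def prodExpect (p : ∀ i, κ i → ℝ) (F : (∀ i, κ i) → ℝ) : ℝ :=
  ∑ f, (∏ i, p i (f i)) * F f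

theorem prodExpect_mono {p : ∀ i, κ i → ℝ} (hp : ∀ i j, 0 ≤ p i j) {F G : (∀ i, κ i) → ℝ}
    (h : ∀ f, F f ≤ G f) : prodExpect p F ≤ prodExpect p G :=
  Finset.sum_le_sum fun f _ =>
    mul_le_mul_of_nonneg_left (h f) (Finset.prod_nonneg fun i _ => hp i (f i))

theorem prodExpect_nonneg {p : ∀ i, κ i → ℝ} (hp : ∀ i j, 0 ≤ p i j) {F : (∀ i, κ i) → ℝ}
    (h : ∀ f, 0 ≤ F f) : 0 ≤ prodExpect p F :=
  Finset.sum_nonneg fun f _ => mul_nonneg (Finset.prod_nonneg fun i _ => hp i (f i)) (h f)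

theorem prodExpect_add (p : ∀ i, κ i → ℝ) (F G : (∀ i, κ i) → ℝ) :
    prodExpect p (fun f => F f + G f) = prodExpect p F + prodExpect p G := by
  simp [prodExpect, mul_add, Finset.sum_add_distrib]

theorem prodExpect_sub (p : ∀ i, κ i → ℝ) (F G : (∀ i, κ i) → ℝ) :
    prodExpect p (fun f => F f - G f) = prodExpect p F - prodExpect p G := by
  simp [prodExpect, mul_sub, Finset.sum_sub_distrib]

theorem prodExpect_const_mul (p : ∀ i, κ i → ℝ) (c : ℝ) (F : (∀ i, κ i) → ℝ) :
    prodExpect p (fun f => c * F f) = c * prodExpect p F := by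
  simp only [prodExpect, Finset.mul_sum]
  exact Finset.sum_congr rfl fun f _ => by ring

theorem prodExpect_sum {α : Type*} (p : ∀ i, κ i → ℝ) (s : Finset α)
    (F : α → (∀ i, κ i) → ℝ) :
    prodExpect p (fun f => ∑ a ∈ s, F a f) = ∑ a ∈ s, prodExpect p (F a) := by
  simp only [prodExpect, Finset.mul_sum]
  exact Finset.sum_comm

theorem prodExpect_one {p : ∀ i, κ i → ℝ} (hsum : ∀ i, ∑ j, p i j = 1) :
    prodExpect p (fun _ => 1) = 1 := by
  simp only [prodExpect, mul_one]
  rw [← Fintype.prod_sum]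
  simp [hsum]

/-- Resampling one coordinate does not change the expectation. -/
theorem prodExpect_resample {p : ∀ i, κ i → ℝ} (hsum : ∀ i, ∑ j, p i j = 1) (i : ι)
    (F : (∀ i, κ i) → ℝ) :
    prodExpect p F = ∑ j, p i j * prodExpect p (fun f => F (Function.update f i j)) := by
  have hw : ∀ (f : ∀ i, κ i) (j : κ i), p i j * ∏ k, p k (f k) =
      p i (f i) * ∏ k, p k (Function.update f i j k) := by
    intro f j
    rw [← Finset.mul_prod_erase _ _ (Finset.mem_univ i),
      ← Finset.mul_prod_erase _ (fun k => p k (Function.update f i j k)) (Finset.mem_univ i)]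
    have : ∏ k ∈ Finset.univ.erase i, p k (Function.update f i j k) =
        ∏ k ∈ Finset.univ.erase i, p k (f k) :=
      Finset.prod_congr rfl fun k hk => by
        rw [Function.update_of_ne (Finset.ne_of_mem_erase hk)]
    rw [this, Function.update_self]
    ring
  -- Exchanging the fresh sample with coordinate `i` is an involution that preserves the product
  -- weight, by `hw`.
  let swap : κ i × (∀ i, κ i) → κ i × (∀ i, κ i) := fun q => (q.2 i, Function.update q.2 i q.1)
  have hswap : Function.Involutive swap := by
    rintro ⟨j, f⟩
    simp [swap]
  calc prodExpect p F
      = ∑ j, ∑ f, p i j * ((∏ k, p k (f k)) * F f) := by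
        simp only [← Finset.mul_sum, ← Finset.sum_mul, hsum, one_mul, prodExpect]
    _ = ∑ q : κ i × (∀ i, κ i), p i q.1 * ((∏ k, p k (q.2 k)) * F q.2) := by
        rw [Fintype.sum_prod_type]
    _ = ∑ q : κ i × (∀ i, κ i),
          p i q.1 * ((∏ k, p k (q.2 k)) * F (Function.update q.2 i q.1)) := by
        refine (Equiv.sum_comp hswap.toPerm _).symm.trans (Finset.sum_congr rfl fun q _ => ?_)
        simp only [Function.Involutive.coe_toPerm, swap]
        rw [← mul_assoc, ← mul_assoc, hw q.2 q.1]
    _ = _ := by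
        rw [Fintype.sum_prod_type]
        simp only [prodExpect, Finset.mul_sum]

/-- A factor depending on one coordinate is independent of a factor that ignores it. -/
theorem prodExpect_mul_of_indep {p : ∀ i, κ i → ℝ} (hsum : ∀ i, ∑ j, p i j = 1) (i : ι)
    (g : κ i → ℝ) (F : (∀ i, κ i) → ℝ) (hF : ∀ f j, F (Function.update f i j) = F f) :
    prodExpect p (fun f => g (f i) * F f) = (∑ j, p i j * g j) * prodExpect p F := by
  rw [prodExpect_resample hsum i, Finset.sum_mul]
  refine Finset.sum_congr rfl fun j _ => ?_
  simp only [Function.update_self, hF]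
  rw [prodExpect_const_mul, mul_assoc]

end ProductExpectation

/-! ### Conditional Chernoff bounds and simultaneous rounding -/

section Rounding

variable {ι ρ : Type*} {κ : ι → Type*}

open Classical in
/-- The indicator of the event that all row sums over the coordinates in `U` are at most `T`. -/
noncomputable def goodInd (A : ρ → ∀ i, κ i → ℝ) (T : ρ → ℝ) (U : Finset ι) (f : ∀ i, κ i) : ℝ :=
  if ∀ r, ∑ i ∈ U, A r i (f i) ≤ T r then 1 else 0

theorem goodInd_nonneg (A : ρ → ∀ i, κ i → ℝ) (T : ρ → ℝ) (U : Finset ι) (f : ∀ i, κ i) :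
    0 ≤ goodInd A T U f := by
  unfold goodInd; split_ifs <;> norm_num

theorem goodInd_anti {A : ρ → ∀ i, κ i → ℝ} (hA : ∀ r i j, 0 ≤ A r i j) (T : ρ → ℝ)
    {U V : Finset ι} (h : U ⊆ V) (f : ∀ i, κ i) : goodInd A T V f ≤ goodInd A T U f := by
  unfold goodInd
  split_ifs with h1 h2 <;> norm_num
  exact h2 fun r => (Finset.sum_le_sum_of_subset_of_nonneg h fun i _ _ => hA r i _).trans (h1 r)

theorem goodInd_update [DecidableEq ι] {A : ρ → ∀ i, κ i → ℝ} {T : ρ → ℝ} {U : Finset ι} {i : ι} (hi : i ∉ U)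
    (f : ∀ i, κ i) (j : κ i) : goodInd A T U (Function.update f i j) = goodInd A T U f := by
  have : ∀ r, ∑ k ∈ U, A r k (Function.update f i j k) = ∑ k ∈ U, A r k (f k) := fun r =>
    Finset.sum_congr rfl fun k hk => by
      rw [Function.update_of_ne (ne_of_mem_of_not_mem hk hi)]
  unfold goodInd
  split_ifs with h1 h2 h2
  · rfl
  · exact absurd (fun r => this r ▸ h1 r) h2
  · exact absurd (fun r => (this r).symm ▸ h2 r) h1
  · rfl

variable [Fintype ι] [∀ i, Fintype (κ i)]

/-- The exponential moment estimate for a row with mean at most `μ`. -/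
theorem prod_one_add_expMoment_le {p : ∀ i, κ i → ℝ} (hp : ∀ i j, 0 ≤ p i j)
    {A : ∀ i, κ i → ℝ} (hA : ∀ i j, A i j ∈ Set.Icc (0 : ℝ) 1) {β l : ℝ} (hβ : 0 ≤ β)
    (hl : 0 ≤ l) (U : Finset ι) :
    ∏ i ∈ U, (1 + β * ∑ j, p i j * (Real.exp (l * A i j) - 1)) ≤
      Real.exp (β * (Real.exp l - 1) * ∑ i, ∑ j, p i j * A i j) := by
  -- By convexity `exp (l t)` lies below its chord on `[0, 1]`, so the bound depends on the row only
  -- through its mean.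
  have hchord : ∀ i j, Real.exp (l * A i j) - 1 ≤ (Real.exp l - 1) * A i j := by
    intro i j
    have := convexOn_exp.2 (Set.mem_univ 0) (Set.mem_univ l) (sub_nonneg.2 (hA i j).2)
      (hA i j).1 (by ring)
    simp only [smul_eq_mul, mul_zero, zero_add, Real.exp_zero, mul_one] at this
    rw [mul_comm l]
    linarith
  have hexp : 0 ≤ Real.exp l - 1 := by linarith [Real.add_one_le_exp l]
  calc ∏ i ∈ U, (1 + β * ∑ j, p i j * (Real.exp (l * A i j) - 1))
      ≤ ∏ i ∈ U, Real.exp (β * ((Real.exp l - 1) * ∑ j, p i j * A i j)) := by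
        refine Finset.prod_le_prod (fun i _ => ?_) fun i _ => ?_
        · refine add_nonneg zero_le_one (mul_nonneg hβ (Finset.sum_nonneg fun j _ =>
            mul_nonneg (hp i j) ?_))
          linarith [Real.add_one_le_exp (l * A i j), mul_nonneg hl (hA i j).1]
        · have : ∑ j, p i j * (Real.exp (l * A i j) - 1) ≤
              (Real.exp l - 1) * ∑ j, p i j * A i j := by
            rw [Finset.mul_sum]
            refine Finset.sum_le_sum fun j _ => ?_
            have := mul_le_mul_of_nonneg_left (hchord i j) (hp i j)
            linarith
          have h2 := Real.add_one_le_exp (β * ((Real.exp l - 1) * ∑ j, p i j * A i j))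
          have h3 := mul_le_mul_of_nonneg_left this hβ
          linarith
    _ = Real.exp (∑ i ∈ U, β * ((Real.exp l - 1) * ∑ j, p i j * A i j)) :=
        (Real.exp_sum _ _).symm
    _ ≤ _ := by
        refine Real.exp_le_exp.2 ?_
        rw [← Finset.mul_sum, ← Finset.mul_sum, ← mul_assoc]
        refine mul_le_mul_of_nonneg_left ?_ (mul_nonneg hβ hexp)
        exact Finset.sum_le_sum_of_subset_of_nonneg (Finset.subset_univ U) fun i _ _ =>
          Finset.sum_nonneg fun j _ => mul_nonneg (hp i j) (hA i j).1

variable [DecidableEq ι]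

/-- Conditioning on the good event inflates the exponential moment of a row by little, if adding
coordinates to the good event costs little. -/
theorem prodExpect_goodInd_mul_prod_le {p : ∀ i, κ i → ℝ} (hp : ∀ i j, 0 ≤ p i j)
    (hsum : ∀ i, ∑ j, p i j = 1) {A : ρ → ∀ i, κ i → ℝ} (hA : ∀ r i j, 0 ≤ A r i j)
    (T : ρ → ℝ) {β : ℝ} (hβ : 0 ≤ β) (φ : ∀ i, κ i → ℝ) (hφ : ∀ i j, 1 ≤ φ i j)
    (V : Finset ι) :
    ∀ U : Finset ι, V ⊆ U →
      (∀ W ⊂ U, ∀ i ∈ U, i ∉ W →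
        prodExpect p (goodInd A T W) ≤ β * prodExpect p (goodInd A T (insert i W))) →
      prodExpect p (fun f => goodInd A T U f * ∏ i ∈ V, φ i (f i)) ≤
        (∏ i ∈ V, (1 + β * ∑ j, p i j * (φ i j - 1))) * prodExpect p (goodInd A T U) := by
  have hprod : ∀ (V : Finset ι) (f : ∀ i, κ i), 0 ≤ ∏ i ∈ V, φ i (f i) := fun V f =>
    Finset.prod_nonneg fun i _ => zero_le_one.trans (hφ i (f i))
  have hψ : ∀ i, 0 ≤ ∑ j, p i j * (φ i j - 1) := fun i =>
    Finset.sum_nonneg fun j _ => mul_nonneg (hp i j) (sub_nonneg.2 (hφ i j))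
  induction V using Finset.induction_on with
  | empty => intro U _ _; simp
  | insert i V hi ih =>
    intro U hVU hstep
    have hiU : i ∈ U := hVU (Finset.mem_insert_self i V)
    have hV : V ⊆ U := (Finset.subset_insert i V).trans hVU
    have hVe : V ⊆ U.erase i := Finset.subset_erase.2 ⟨hV, hi⟩
    have h1 := ih U hV hstep
    -- The claim for `V` is used twice, with good events `U` and `U.erase i`; this is why `U` is
    -- quantified inside the induction on `V`.
    have h2 := ih (U.erase i) hVe fun W hW k hk hkW =>
      hstep W (hW.trans (Finset.erase_ssubset hiU)) k (Finset.mem_of_mem_erase hk) hkW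
    have h3 := hstep (U.erase i) (Finset.erase_ssubset hiU) i hiU (Finset.notMem_erase i U)
    rw [Finset.insert_erase hiU] at h3
    have hQ : 0 ≤ ∏ i ∈ V, (1 + β * ∑ j, p i j * (φ i j - 1)) :=
      Finset.prod_nonneg fun i _ => add_nonneg zero_le_one (mul_nonneg hβ (hψ i))
    have h4 : prodExpect p (fun f => (φ i (f i) - 1) *
          (goodInd A T (U.erase i) f * ∏ i ∈ V, φ i (f i))) =
        (∑ j, p i j * (φ i j - 1)) *
          prodExpect p (fun f => goodInd A T (U.erase i) f * ∏ i ∈ V, φ i (f i)) := by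
      refine prodExpect_mul_of_indep hsum i (fun j => φ i j - 1) _ fun f j => ?_
      rw [goodInd_update (Finset.notMem_erase i U)]
      congr 1
      exact Finset.prod_congr rfl fun k hk => by
        rw [Function.update_of_ne (ne_of_mem_of_not_mem hk hi)]
    calc prodExpect p (fun f => goodInd A T U f * ∏ i ∈ insert i V, φ i (f i))
        ≤ prodExpect p (fun f => goodInd A T U f * ∏ i ∈ V, φ i (f i) +
            (φ i (f i) - 1) * (goodInd A T (U.erase i) f * ∏ i ∈ V, φ i (f i))) := by
          refine prodExpect_mono hp fun f => ?_
          rw [Finset.prod_insert hi]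
          have h5 : goodInd A T U f * ∏ i ∈ V, φ i (f i) ≤
              goodInd A T (U.erase i) f * ∏ i ∈ V, φ i (f i) :=
            mul_le_mul_of_nonneg_right (goodInd_anti hA T (Finset.erase_subset i U) f) (hprod V f)
          have h6 := mul_le_mul_of_nonneg_left h5 (sub_nonneg.2 (hφ i (f i)))
          linarith
      _ ≤ (∏ i ∈ V, (1 + β * ∑ j, p i j * (φ i j - 1))) * prodExpect p (goodInd A T U) +
          (∑ j, p i j * (φ i j - 1)) * ((∏ i ∈ V, (1 + β * ∑ j, p i j * (φ i j - 1))) *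
            (β * prodExpect p (goodInd A T U))) := by
          rw [prodExpect_add, h4]
          exact add_le_add h1 (mul_le_mul_of_nonneg_left
            (h2.trans (mul_le_mul_of_nonneg_left h3 hQ)) (hψ i))
      _ = _ := by
          rw [Finset.prod_insert hi]
          ring

variable [Fintype ρ]

open Classical in
/-- Adding one coordinate to the good event costs at most a factor `1 - a * q`. -/
theorem prodExpect_goodInd_le_insert {p : ∀ i, κ i → ℝ} (hp : ∀ i j, 0 ≤ p i j)
    (hsum : ∀ i, ∑ j, p i j = 1) {A : ρ → ∀ i, κ i → ℝ}
    (hA : ∀ r i j, A r i j ∈ Set.Icc (0 : ℝ) 1) {a : ℕ}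
    (ha : ∀ i j, (Finset.univ.filter fun r => A r i j ≠ 0).card ≤ a) {D q β l : ℝ}
    (hl : 0 ≤ l) (hq : 0 ≤ q) (hβ : 0 ≤ β) (haq : 1 ≤ β * (1 - a * q))
    (hrow : ∀ r, Real.exp (β * (Real.exp l - 1) * (∑ i, ∑ j, p i j * A r i j) -
      l * ((∑ i, ∑ j, p i j * A r i j) + D - 1)) ≤ q) (U : Finset ι) :
    ∀ i ∉ U, prodExpect p (goodInd A (fun r => (∑ i, ∑ j, p i j * A r i j) + D) U) ≤
      β * prodExpect p (goodInd A (fun r => (∑ i, ∑ j, p i j * A r i j) + D) (insert i U)) := by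
  set T : ρ → ℝ := fun r => (∑ i, ∑ j, p i j * A r i j) + D with hT
  have hA0 : ∀ r i j, 0 ≤ A r i j := fun r i j => (hA r i j).1
  induction U using Finset.strongInduction with
  | H U ih =>
    intro i hi
    have hPU : 0 ≤ prodExpect p (goodInd A T U) :=
      prodExpect_nonneg hp fun f => goodInd_nonneg A T U f
    -- Markov's inequality in exponential form, restricted to the good event. The hypothesis on
    -- proper subsets of `U` is exactly what strong induction provides.
    have hbad : ∀ r, prodExpect p (fun f => Real.exp (-(l * (T r - 1))) *
        (goodInd A T U f * ∏ k ∈ U, Real.exp (l * A r k (f k)))) ≤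
          q * prodExpect p (goodInd A T U) := by
      intro r
      rw [prodExpect_const_mul]
      have h1 := prodExpect_goodInd_mul_prod_le hp hsum hA0 T hβ
        (fun k j => Real.exp (l * A r k j))
        (fun k j => Real.one_le_exp (mul_nonneg hl (hA0 r k j))) U U subset_rfl
        fun W hW k _ hkW => ih W hW k hkW
      have h2 := prod_one_add_expMoment_le hp (hA r) hβ hl U
      calc _ ≤ Real.exp (-(l * (T r - 1))) * (Real.exp (β * (Real.exp l - 1) *
            ∑ i, ∑ j, p i j * A r i j) * prodExpect p (goodInd A T U)) :=
            mul_le_mul_of_nonneg_left (h1.trans (mul_le_mul_of_nonneg_right h2 hPU))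
              (Real.exp_nonneg _)
        _ = Real.exp (β * (Real.exp l - 1) * (∑ i, ∑ j, p i j * A r i j) -
              l * ((∑ i, ∑ j, p i j * A r i j) + D - 1)) * prodExpect p (goodInd A T U) := by
            rw [← mul_assoc, ← Real.exp_add]
            congr 2
            simp only [hT]
            ring
        _ ≤ _ := mul_le_mul_of_nonneg_right (hrow r) hPU
    -- Pointwise union bound for setting coordinate `i` to `j`: a row that becomes bad has `A r i j
    -- ≠ 0`, and since this entry is at most 1 its old sum exceeds `T r - 1`, so its exponential
    -- term is at least 1.
    have hpt : ∀ (j : κ i) (f : ∀ i, κ i),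
        goodInd A T U f - ∑ r ∈ Finset.univ.filter (fun r => A r i j ≠ 0),
          Real.exp (-(l * (T r - 1))) *
            (goodInd A T U f * ∏ k ∈ U, Real.exp (l * A r k (f k))) ≤
        goodInd A T (insert i U) (Function.update f i j) := by
      intro j f
      have hnn : ∀ r ∈ Finset.univ.filter (fun r => A r i j ≠ 0),
          0 ≤ Real.exp (-(l * (T r - 1))) *
            (goodInd A T U f * ∏ k ∈ U, Real.exp (l * A r k (f k))) := fun r _ =>
        mul_nonneg (Real.exp_nonneg _) (mul_nonneg (goodInd_nonneg A T U f)
          (Finset.prod_nonneg fun k _ => Real.exp_nonneg _))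
      by_cases hgood : ∀ r, ∑ k ∈ U, A r k (f k) ≤ T r
      swap
      · have h0 : goodInd A T U f = 0 := if_neg hgood
        simp only [h0, zero_mul, mul_zero, Finset.sum_const_zero, sub_zero]
        exact goodInd_nonneg _ _ _ _
      have h1 : goodInd A T U f = 1 := if_pos hgood
      have hrowsum : ∀ r, ∑ k ∈ insert i U, A r k (Function.update f i j k) =
          A r i j + ∑ k ∈ U, A r k (f k) := fun r => by
        rw [Finset.sum_insert hi, Function.update_self]
        congr 1
        exact Finset.sum_congr rfl fun k hk => by
          rw [Function.update_of_ne (ne_of_mem_of_not_mem hk hi)]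
      by_cases hgood' : ∀ r, ∑ k ∈ insert i U, A r k (Function.update f i j k) ≤ T r
      · have h2 : goodInd A T (insert i U) (Function.update f i j) = 1 := if_pos hgood'
        rw [h2, h1]
        have := Finset.sum_nonneg hnn
        rw [h1] at this
        linarith
      · have h2 : goodInd A T (insert i U) (Function.update f i j) = 0 := if_neg hgood'
        rw [h2, sub_nonpos, h1]
        rw [h1] at hnn
        push Not at hgood'
        obtain ⟨r, hr⟩ := hgood'
        rw [hrowsum r] at hr
        have hrA : A r i j ≠ 0 := fun h0 => by
          have := hgood r
          rw [h0] at hr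
          linarith
        refine le_trans ?_ (Finset.single_le_sum hnn
          (Finset.mem_filter.2 ⟨Finset.mem_univ r, hrA⟩))
        rw [one_mul, ← Real.exp_sum, ← Real.exp_add, ← Finset.mul_sum]
        refine Real.one_le_exp ?_
        have := mul_nonneg hl (sub_nonneg.2 (show T r - 1 ≤ ∑ k ∈ U, A r k (f k) by
          linarith [(hA r i j).2]))
        linarith
    have hj : ∀ j : κ i, (1 - a * q) * prodExpect p (goodInd A T U) ≤
        prodExpect p (fun f => goodInd A T (insert i U) (Function.update f i j)) := by
      intro j
      refine le_trans ?_ (prodExpect_mono hp (hpt j))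
      rw [prodExpect_sub, prodExpect_sum]
      have h1 := Finset.sum_le_card_nsmul (Finset.univ.filter fun r => A r i j ≠ 0) _ _
        fun r _ => hbad r
      rw [nsmul_eq_mul] at h1
      have h2 : ((Finset.univ.filter fun r => A r i j ≠ 0).card : ℝ) ≤ a := by
        exact_mod_cast ha i j
      have h3 := mul_le_mul_of_nonneg_right h2 (mul_nonneg hq hPU)
      linarith
    have hins : (1 - a * q) * prodExpect p (goodInd A T U) ≤
        prodExpect p (goodInd A T (insert i U)) := by
      rw [prodExpect_resample hsum i (goodInd A T (insert i U))]
      calc (1 - a * q) * prodExpect p (goodInd A T U)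
          = ∑ j, p i j * ((1 - a * q) * prodExpect p (goodInd A T U)) := by
            rw [← Finset.sum_mul, hsum, one_mul]
        _ ≤ _ := Finset.sum_le_sum fun j _ => mul_le_mul_of_nonneg_left (hj j) (hp i j)
    calc prodExpect p (goodInd A T U)
        ≤ (β * (1 - a * q)) * prodExpect p (goodInd A T U) := le_mul_of_one_le_left hPU haq
      _ = β * ((1 - a * q) * prodExpect p (goodInd A T U)) := mul_assoc _ _ _
      _ ≤ _ := mul_le_mul_of_nonneg_left hins hβ

open Classical in
/-- Simultaneous rounding of all coordinates with additive row error `D`, supported on the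
positive probabilities. The number of rows does not enter, only the column sparsity `a`. -/
theorem exists_rounding {p : ∀ i, κ i → ℝ} (hp : ∀ i j, 0 ≤ p i j)
    (hsum : ∀ i, ∑ j, p i j = 1) {A : ρ → ∀ i, κ i → ℝ}
    (hA : ∀ r i j, A r i j ∈ Set.Icc (0 : ℝ) 1) {a : ℕ}
    (ha : ∀ i j, (Finset.univ.filter fun r => A r i j ≠ 0).card ≤ a) {D q β l : ℝ}
    (hD : 0 ≤ D) (hl : 0 ≤ l) (hq : 0 ≤ q) (hβ : 0 ≤ β) (haq : 1 ≤ β * (1 - a * q))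
    (hrow : ∀ r, Real.exp (β * (Real.exp l - 1) * (∑ i, ∑ j, p i j * A r i j) -
      l * ((∑ i, ∑ j, p i j * A r i j) + D - 1)) ≤ q) :
    ∃ f : ∀ i, κ i, (∀ i, 0 < p i (f i)) ∧
      ∀ r, ∑ i, A r i (f i) ≤ (∑ i, ∑ j, p i j * A r i j) + D := by
  set T : ρ → ℝ := fun r => (∑ i, ∑ j, p i j * A r i j) + D with hT
  have hT0 : ∀ r, 0 ≤ T r := fun r => add_nonneg (Finset.sum_nonneg fun i _ =>
    Finset.sum_nonneg fun j _ => mul_nonneg (hp i j) (hA r i j).1) hD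
  -- Each added coordinate costs at most a factor `β`, so positivity propagates from `U = ∅`, where
  -- the event is certain because `T r ≥ 0`.
  have hpos : ∀ U : Finset ι, 0 < prodExpect p (goodInd A T U) := by
    intro U
    induction U using Finset.induction_on with
    | empty =>
      have : goodInd A T ∅ = fun _ => 1 := funext fun f => if_pos fun r => by simpa using hT0 r
      rw [this, prodExpect_one hsum]
      exact one_pos
    | insert i U hi ih =>
      exact pos_of_mul_pos_right (ih.trans_le (prodExpect_goodInd_le_insert hp hsum hA ha hl hq hβ
        haq hrow U i hi)) hβ
  obtain ⟨f, -, hf⟩ := Finset.exists_lt_of_sum_lt (s := Finset.univ) (f := fun _ => (0 : ℝ))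
    (g := fun f : ∀ i, κ i => (∏ i, p i (f i)) * goodInd A T Finset.univ f)
    (by simpa [prodExpect] using hpos Finset.univ)
  have hprod : ∏ i, p i (f i) ≠ 0 := left_ne_zero_of_mul hf.ne'
  refine ⟨f, fun i => (hp i (f i)).lt_of_ne' (Finset.prod_ne_zero_iff.1 hprod i
    (Finset.mem_univ i)), ?_⟩
  by_contra hcon
  exact right_ne_zero_of_mul hf.ne' (if_neg hcon)

end Rounding

/-! ### Choice of the Chernoff parameters -/

/-- The parameters of `exists_rounding` for a common bound `μ` on the row means. The additive error
`D` is of the order of the large-deviation function. -/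
theorem exists_rounding_parameters {a : ℕ} (ha : 1 ≤ a) {μ : ℝ} (hμ : 0 ≤ μ) :
    ∃ D q β l : ℝ, 0 ≤ D ∧ D ≤ 8 + 6 * (μ * devH μ (1 / (a : ℝ))) ∧ 0 ≤ l ∧ 0 ≤ q ∧ 1 ≤ β ∧
      1 ≤ β * (1 - a * q) ∧
      Real.exp (β * (Real.exp l - 1) * μ - l * (μ + D - 1)) ≤ q := by
  have ha1 : (1 : ℝ) ≤ a := by exact_mod_cast ha
  have ha0 : (0 : ℝ) < a := by linarith
  have hln2 : 0 < Real.log 2 := Real.log_pos one_lt_two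
  have hln2' : Real.log 2 < 0.7 := by linarith [Real.log_two_lt_d9]
  have hln2'' : 0.6 < Real.log 2 := by linarith [Real.log_two_gt_d9]
  have hlog : ∀ x : ℝ, Real.log x = Real.log 2 * Real.logb 2 x := fun x => by
    rw [Real.logb]; field_simp
  have hla : 0 ≤ Real.logb 2 a := Real.logb_nonneg one_lt_two ha1
  have hl2a : Real.log (2 * a) ≤ 0.7 + 0.7 * Real.logb 2 a := by
    rw [Real.log_mul two_ne_zero ha0.ne', hlog a]
    nlinarith
  -- it suffices to bound the exponent, with `β = 1 + η` and `q = η / ((1 + η) a)`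
  have key : ∀ D η l : ℝ, 0 < η → η ≤ 1 →
      (1 + η) * (Real.exp l - 1) * μ + Real.log (2 * a / η) ≤ l * (μ + D - 1) →
      1 ≤ (1 + η) * (1 - a * (η / ((1 + η) * a))) ∧
        Real.exp ((1 + η) * (Real.exp l - 1) * μ - l * (μ + D - 1)) ≤ η / ((1 + η) * a) := by
    intro D η l hη hη1 h
    constructor
    · apply le_of_eq; field_simp; ring
    · calc _ ≤ Real.exp (-Real.log (2 * a / η)) := Real.exp_le_exp.2 (by linarith)
        _ = η / (2 * a) := by
          rw [Real.exp_neg, Real.exp_log (by positivity), inv_div]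
        _ ≤ _ := by gcongr; linarith
  rcases hμ.eq_or_lt with rfl | hμ
  · have h := key 2 1 (Real.log (2 * a)) one_pos le_rfl (by norm_num)
    exact ⟨2, _, _, _, by norm_num, by norm_num, Real.log_nonneg (by linarith), by positivity,
      by norm_num, h⟩
  rw [devH, one_div, inv_inv]
  split_ifs with hc
  -- Small mean: `exp l = L / μ` balances the moment term `2 μ exp l = 2 L` against `log (2 a)`,
  -- also of order `L`; the gain `l (D - 1)` is `6 L log 2`, which covers both.
  · set L := Real.logb 2 a with hL
    have hLpos : 0 < L := by linarith
    have hR : 2 ≤ L / μ := by rw [le_div_iff₀ hμ]; linarith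
    have hRpos : 0 < L / μ := by linarith
    have hlR : 1 ≤ Real.logb 2 (L / μ) := by
      rw [Real.le_logb_iff_rpow_le one_lt_two hRpos]; simpa using hR
    have ha2 : 1 ≤ L := by
      rw [hL, Real.le_logb_iff_rpow_le one_lt_two ha0, Real.rpow_one]
      have : (1 : ℝ) < a := by
        by_contra hcon
        have : (a : ℝ) = 1 := le_antisymm (not_lt.1 hcon) ha1
        rw [hL, this, Real.logb_one] at hLpos
        exact lt_irrefl _ hLpos
      exact_mod_cast (show 1 < a by exact_mod_cast this)
    have hF : μ * (L / (μ * Real.logb 2 (L / μ))) = L / Real.logb 2 (L / μ) := by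
      field_simp
    have hF0 : 0 ≤ L / Real.logb 2 (L / μ) := by positivity
    have h := key (1 + 6 * (L / Real.logb 2 (L / μ))) 1 (Real.log (L / μ)) one_pos le_rfl (by
      rw [Real.exp_log hRpos, div_one]
      have h1 : Real.log (L / μ) * (6 * (L / Real.logb 2 (L / μ))) = 6 * Real.log 2 * L := by
        rw [hlog (L / μ)]; field_simp
      have h2 : 0 ≤ Real.log (L / μ) * μ := mul_nonneg (Real.log_nonneg (by linarith)) hμ.le
      have h3 : L / μ * μ = L := div_mul_cancel₀ _ hμ.ne'
      nlinarith)
    refine ⟨_, _, _, _, by positivity, ?_, Real.log_nonneg (by linarith), by positivity,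
      by norm_num, h⟩
    rw [hF]; linarith
  · push Not at hc
    set G := Real.logb 2 (μ + a) with hG
    have hsum1 : 1 < μ + a := by linarith
    have hGpos : 0 < G := Real.logb_pos one_lt_two hsum1
    have haG : Real.logb 2 a ≤ G := Real.logb_le_logb_of_le one_lt_two ha0 (by linarith)
    have hF : μ * Real.sqrt (G / μ) = Real.sqrt (μ * G) := by
      rw [Real.sqrt_div hGpos.le, Real.sqrt_mul hμ.le]
      have : 0 < Real.sqrt μ := Real.sqrt_pos.2 hμ
      field_simp
      rw [Real.sq_sqrt hμ.le]
    by_cases hGμ : G ≤ μ ∧ 1 ≤ μ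
    · obtain ⟨hGμ, hμ1⟩ := hGμ
      set l := Real.sqrt (G / μ) with hl
      have hlpos : 0 < l := Real.sqrt_pos.2 (by positivity)
      have hl1 : l ≤ 1 := by
        rw [hl, Real.sqrt_le_one]; exact (div_le_one hμ).2 hGμ
      have hlsq : l ^ 2 * μ = G := by
        rw [hl, Real.sq_sqrt (by positivity)]; field_simp
      have hG1 : 1 ≤ G := by
        rw [hG, Real.le_logb_iff_rpow_le one_lt_two (by linarith), Real.rpow_one]
        linarith
      -- Gaussian regime. Taking `η = l` makes the inflation `β = 1 + l` cost about `l ^ 2 * μ = G`,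
      -- the size of the second-order term of `exp l`; a constant `η` would cost order `l μ`. The
      -- price is `-log l` inside `log (2 a / l)`, absorbed by `log (μ + a)`.
      have h := key (1 + 6 * (μ * l)) l l hlpos hl1 (by
        have hexp : Real.exp l - 1 ≤ l + l ^ 2 := by
          have := (abs_le.1 (Real.abs_exp_sub_one_sub_id_le (abs_le.2 ⟨by linarith, hl1⟩))).2
          linarith
        have h1 : (1 + l) * (Real.exp l - 1) * μ ≤ l * μ + 3 * G := by
          have h2 : (1 + l) * (Real.exp l - 1) ≤ l + 3 * l ^ 2 := by
            nlinarith [sq_nonneg l, mul_nonneg (sq_nonneg l) (sub_nonneg.2 hl1)]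
          have h3 := mul_le_mul_of_nonneg_right h2 hμ.le
          nlinarith
        have h2 : Real.log (2 * a / l) ≤ 3 * G := by
          rw [Real.log_div (by positivity) hlpos.ne']
          have h3 : -Real.log l ≤ Real.log (μ + a) := by
            rw [← Real.log_inv]
            refine Real.log_le_log (by positivity) ?_
            have : l⁻¹ ^ 2 ≤ (μ + a) ^ 2 := by
              have h5 : l⁻¹ ^ 2 = μ / G := by
                rw [inv_pow, inv_eq_iff_eq_inv, inv_div, ← hlsq]; field_simp
              rw [h5, div_le_iff₀ hGpos]
              nlinarith
            exact le_of_sq_le_sq this (by linarith)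
          rw [hlog (μ + a), ← hG] at h3
          nlinarith
        have h3 : l * (6 * (μ * l)) = 6 * G := by rw [← hlsq]; ring
        linarith)
      refine ⟨_, _, _, _, by positivity, by linarith, hlpos.le, by positivity, by linarith, h⟩
    -- Here `μ < 1` or `μ < G`, so an error of order `1 + μ` is affordable and constants `l = η = 1`
    -- suffice; `log (2 a)` is controlled by `hc`.
    · have hFμ : μ ≤ 1 + Real.sqrt (μ * G) := by
        rcases le_or_gt G μ with h1 | h1
        · have h2 : μ < 1 := not_le.1 fun h2 => hGμ ⟨h1, h2⟩
          linarith [Real.sqrt_nonneg (μ * G)]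
        · linarith [Real.le_sqrt_of_sq_le (show μ ^ 2 ≤ μ * G by nlinarith)]
      have h := key (2 + 6 * μ) 1 1 one_pos le_rfl (by
        have := Real.exp_one_lt_d9
        rw [div_one]
        nlinarith)
      exact ⟨_, _, _, _, by positivity, by rw [hF]; linarith, zero_le_one, by positivity,
        by norm_num, h⟩

open Classical in
/-- Rounding with an additive error of the order of the large-deviation function. -/
theorem exists_rounding_devH {ι ρ : Type*} [Fintype ι] [Fintype ρ] {κ : ι → Type*}
    [∀ i, Fintype (κ i)] {p : ∀ i, κ i → ℝ} (hp : ∀ i j, 0 ≤ p i j)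
    (hsum : ∀ i, ∑ j, p i j = 1) {A : ρ → ∀ i, κ i → ℝ}
    (hA : ∀ r i j, A r i j ∈ Set.Icc (0 : ℝ) 1) {a : ℕ}
    (ha : ∀ i j, (Finset.univ.filter fun r => A r i j ≠ 0).card ≤ a) {μ : ℝ} (hμ : 0 ≤ μ)
    (hμa : a = 0 → μ = 0) (hrow : ∀ r, ∑ i, ∑ j, p i j * A r i j ≤ μ) :
    ∃ f : ∀ i, κ i, (∀ i, 0 < p i (f i)) ∧
      ∀ r, ∑ i, A r i (f i) ≤
        (∑ i, ∑ j, p i j * A r i j) + (8 + 6 * (μ * devH μ (1 / (a : ℝ)))) := by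
  -- For `a = 0` the sparsity bound is weakened to 1; the error term does not change because then `μ
  -- = 0`.
  obtain ⟨b, hb1, hab, hdev⟩ : ∃ b : ℕ, 1 ≤ b ∧ a ≤ b ∧
      μ * devH μ (1 / (b : ℝ)) = μ * devH μ (1 / (a : ℝ)) := by
    rcases Nat.eq_zero_or_pos a with h | h
    · exact ⟨1, le_rfl, by omega, by rw [hμa h, zero_mul, zero_mul]⟩
    · exact ⟨a, h, le_rfl, rfl⟩
  obtain ⟨D, q, β, l, hD0, hD, hl, hq, hβ, hbq, hexp⟩ := exists_rounding_parameters hb1 hμ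
  obtain ⟨f, hf, hfr⟩ := exists_rounding hp hsum hA (fun i j => (ha i j).trans hab) hD0 hl hq
    (zero_le_one.trans hβ) hbq fun r => by
      refine (Real.exp_le_exp.2 ?_).trans hexp
      -- The exponent is nondecreasing in the row mean, so the worst case is mean `μ`.
      have h1 : l ≤ β * (Real.exp l - 1) := by
        nlinarith [Real.add_one_le_exp l]
      have h2 := mul_le_mul_of_nonneg_left (hrow r) (sub_nonneg.2 h1)
      linarith
  exact ⟨f, hf, fun r => (hfr r).trans (by linarith)⟩

/-! ### Sparse optimal solutions of the LP relaxation -/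

namespace MinimaxIP

variable {m n : ℕ} (P : MinimaxIP m n)

theorem mulVec_apply_sum (x : ((i : Fin n) × Fin (P.ℓ i)) → ℝ) (r : Fin m) :
    P.A.mulVec x r = ∑ i, ∑ j, x ⟨i, j⟩ * P.A r ⟨i, j⟩ := by
  rw [Matrix.mulVec, dotProduct, Fintype.sum_sigma]
  simp only [mul_comm]

/-- The linear programming relaxation attains its optimal value. -/
theorem exists_isFractionalSolution_lpValue (hm : 0 < m) (hℓ : ∀ i, 0 < P.ℓ i) :
    ∃ x, P.IsFractionalSolution x P.lpValue := by
  have : NeZero m := ⟨hm.ne'⟩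
  let K : Set (((i : Fin n) × Fin (P.ℓ i)) → ℝ) :=
    Set.Icc 0 1 ∩ {x | ∀ i, ∑ j, x ⟨i, j⟩ = 1}
  have hK : IsCompact K := by
    refine isCompact_Icc.inter_right ?_
    rw [Set.ofPred_forall]
    exact isClosed_iInter fun i => isClosed_eq (by fun_prop) continuous_const
  have hne : K.Nonempty := by
    refine ⟨fun c => if c.2 = ⟨0, hℓ c.1⟩ then 1 else 0, ⟨fun c => ?_, fun c => ?_⟩, fun i => ?_⟩
    · dsimp only; split_ifs <;> norm_num
    · dsimp only; split_ifs <;> norm_num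
    · change ∑ j, (if j = (⟨0, hℓ i⟩ : Fin (P.ℓ i)) then (1 : ℝ) else 0) = 1
      rw [Finset.sum_ite_eq' Finset.univ, if_pos (Finset.mem_univ _)]
  let g : (((i : Fin n) × Fin (P.ℓ i)) → ℝ) → ℝ := fun x =>
    Finset.univ.sup' Finset.univ_nonempty fun r => P.A.mulVec x r
  have hg : Continuous g := by
    refine Continuous.finset_sup'_apply _ fun r _ => ?_
    simp only [Matrix.mulVec, dotProduct]
    fun_prop
  obtain ⟨x, hxK, hx⟩ := hK.exists_isMinOn hne hg.continuousOn
  have hfeas : P.IsFractionalSolution x (g x) :=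
    ⟨fun c => ⟨hxK.1.1 c, hxK.1.2 c⟩, hxK.2, fun r =>
      Finset.le_sup' (fun r => P.A.mulVec x r) (Finset.mem_univ r)⟩
  have hleast : IsLeast {W : ℝ | ∃ x, P.IsFractionalSolution x W} (g x) := by
    refine ⟨⟨x, hfeas⟩, ?_⟩
    rintro W ⟨z, hz, hz1, hzW⟩
    exact (isMinOn_iff.1 hx z ⟨⟨fun c => (hz c).1, fun c => (hz c).2⟩, hz1⟩).trans
      (Finset.sup'_le _ _ fun r _ => hzW r)
  exact ⟨x, by rw [lpValue, hleast.csInf_eq]; exact hfeas⟩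

/-- If the support of a fractional solution is larger than the number of constraints, then it can
be made smaller. -/
theorem exists_isFractionalSolution_support_ssubset {x : ((i : Fin n) × Fin (P.ℓ i)) → ℝ} {W : ℝ}
    (hx : P.IsFractionalSolution x W)
    (hcard : n + m < (Finset.univ.filter fun c => x c ≠ 0).card) :
    ∃ y, P.IsFractionalSolution y W ∧
      (Finset.univ.filter fun c => y c ≠ 0) ⊂ Finset.univ.filter fun c => x c ≠ 0 := by
  -- A kernel vector is a direction that preserves the group sums and all row values and vanishes
  -- off the support of `x`. Counting dimensions, a nonzero one exists once the support exceeds `n +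
  -- m`.
  let Φ : ((((i : Fin n) × Fin (P.ℓ i)) → ℝ)) →ₗ[ℝ]
      (Fin n → ℝ) × (Fin m → ℝ) × ({c // x c = 0} → ℝ) :=
    LinearMap.prod (LinearMap.pi fun i => ∑ j, LinearMap.proj ⟨i, j⟩)
      (LinearMap.prod (Matrix.mulVecLin P.A) (LinearMap.pi fun c => LinearMap.proj c.1))
  have hker : LinearMap.ker Φ ≠ ⊥ := by
    refine LinearMap.ker_ne_bot_of_finrank_lt ?_
    simp only [Module.finrank_prod, Module.finrank_pi, Fintype.card_fin]
    rw [Fintype.card_subtype]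
    have := Finset.card_filter_add_card_filter_not (s := Finset.univ) (fun c => x c = 0)
    have hcard' : n + m < (Finset.univ.filter fun c => ¬ x c = 0).card := by convert hcard
    rw [Finset.card_univ] at this
    omega
  obtain ⟨z, hzker, hz0⟩ := (Submodule.ne_bot_iff _).1 hker
  have hΦ : Φ z = 0 := hzker
  have hz1 : ∀ i, ∑ j, z ⟨i, j⟩ = 0 := fun i => by
    simpa [Φ] using congrFun (congrArg Prod.fst hΦ) i
  have hz2 : P.A.mulVec z = 0 := congrArg (fun q => q.2.1) hΦ
  have hz3 : ∀ c, x c = 0 → z c = 0 := fun c hc =>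
    congrFun (congrArg (fun q => q.2.2) hΦ) ⟨c, hc⟩
  have hneg : ∃ c, z c < 0 := by
    by_contra! hcon
    refine hz0 (funext fun ⟨i, j⟩ => ?_)
    exact (Finset.sum_eq_zero_iff_of_nonneg fun j _ => hcon ⟨i, j⟩).1 (hz1 i) j
      (Finset.mem_univ j)
  -- Ratio test: go along `z` until the first coordinate reaches 0. The upper bounds `≤ 1` then
  -- follow from nonnegativity and the group sums.
  obtain ⟨c₀, hc₀, hmin⟩ := Finset.exists_min_image (Finset.univ.filter fun c => z c < 0)
    (fun c => x c / -z c) (by obtain ⟨c, hc⟩ := hneg; exact ⟨c, by simpa using hc⟩)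
  simp only [Finset.mem_filter, Finset.mem_univ, true_and] at hc₀ hmin
  set t := x c₀ / -z c₀ with ht
  have ht0 : 0 ≤ t := div_nonneg (hx.1 c₀).1 (by linarith)
  have hy0 : ∀ c, 0 ≤ x c + t * z c := by
    intro c
    rcases lt_or_ge (z c) 0 with hc | hc
    · have := hmin c hc
      rw [le_div_iff₀ (by linarith)] at this
      linarith
    · exact add_nonneg (hx.1 c).1 (mul_nonneg ht0 hc)
  have hysum : ∀ i, ∑ j, (x ⟨i, j⟩ + t * z ⟨i, j⟩) = 1 := fun i => by
    rw [Finset.sum_add_distrib, ← Finset.mul_sum, hz1, hx.2.1 i, mul_zero, add_zero]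
  refine ⟨x + t • z, ⟨fun c => ⟨hy0 c, ?_⟩, hysum, fun r => ?_⟩, ?_⟩
  · obtain ⟨i, j⟩ := c
    rw [← hysum i]
    exact Finset.single_le_sum (f := fun j => x ⟨i, j⟩ + t * z ⟨i, j⟩) (fun j _ => hy0 ⟨i, j⟩)
      (Finset.mem_univ j)
  · rw [Matrix.mulVec_add, Matrix.mulVec_smul, hz2, smul_zero, add_zero]
    exact hx.2.2 r
  · refine Finset.ssubset_iff_subset_ne.2 ⟨fun c hc => ?_, fun heq => ?_⟩
    · simp only [Finset.mem_filter, Finset.mem_univ, true_and] at hc ⊢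
      exact fun h0 => hc (by simp [h0, hz3 c h0])
    · have h1 : c₀ ∈ Finset.univ.filter fun c => x c ≠ 0 := by
        simp only [Finset.mem_filter, Finset.mem_univ, true_and]
        exact fun h0 => hc₀.ne (hz3 c₀ h0)
      rw [← heq] at h1
      simp only [Finset.mem_filter, Finset.mem_univ, true_and] at h1
      refine h1 ?_
      have : z c₀ ≠ 0 := hc₀.ne
      simp only [Pi.add_apply, Pi.smul_apply, smul_eq_mul, ht]
      field_simp
      ring

/-- Some optimal fractional solution has at most as many non-integral groups as there are
inequality constraints. -/
theorem exists_isFractionalSolution_card_le {W : ℝ} (h : ∃ x, P.IsFractionalSolution x W) :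
    ∃ x, P.IsFractionalSolution x W ∧
      (Finset.univ.filter fun i : Fin n =>
        1 < (Finset.univ.filter fun j => x ⟨i, j⟩ ≠ 0).card).card ≤ m := by
  obtain ⟨k, ⟨x, hx, hk⟩, hkmin⟩ : ∃ k : ℕ,
      (∃ x, P.IsFractionalSolution x W ∧ (Finset.univ.filter fun c => x c ≠ 0).card = k) ∧
      ∀ k' < k, ¬ ∃ x, P.IsFractionalSolution x W ∧
        (Finset.univ.filter fun c => x c ≠ 0).card = k' := by
    classical
    have hex : ∃ k : ℕ, ∃ x, P.IsFractionalSolution x W ∧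
        (Finset.univ.filter fun c => x c ≠ 0).card = k := by
      obtain ⟨x, hx⟩ := h
      exact ⟨_, x, hx, rfl⟩
    exact ⟨Nat.find hex, Nat.find_spec hex, fun k' hk' => Nat.find_min hex hk'⟩
  have hle : (Finset.univ.filter fun c => x c ≠ 0).card ≤ n + m := by
    by_contra! hcon
    obtain ⟨y, hy, hss⟩ := P.exists_isFractionalSolution_support_ssubset hx hcon
    exact hkmin _ (hk ▸ Finset.card_lt_card hss) ⟨y, hy, rfl⟩
  have hcard : (Finset.univ.filter fun c => x c ≠ 0).card =
      ∑ i, (Finset.univ.filter fun j => x ⟨i, j⟩ ≠ 0).card := by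
    simp only [Finset.card_filter, Fintype.sum_sigma]
  -- Every group uses at least one support element and a fractional group at least two, so a support
  -- of size at most `n + m` allows at most `m` fractional groups.
  have hgroup : ∀ i, 1 + (if 1 < (Finset.univ.filter fun j => x ⟨i, j⟩ ≠ 0).card then 1 else 0) ≤
      (Finset.univ.filter fun j => x ⟨i, j⟩ ≠ 0).card := by
    intro i
    have : 0 < (Finset.univ.filter fun j => x ⟨i, j⟩ ≠ 0).card := by
      obtain ⟨j, -, hj⟩ := Finset.exists_ne_zero_of_sum_ne_zero
        (show ∑ j, x ⟨i, j⟩ ≠ 0 by rw [hx.2.1 i]; exact one_ne_zero)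
      exact Finset.card_pos.2 ⟨j, by simpa using hj⟩
    split_ifs <;> omega
  have hsum := Finset.sum_le_sum fun i (_ : i ∈ Finset.univ) => hgroup i
  rw [Finset.sum_add_distrib, ← hcard, ← Finset.card_filter] at hsum
  simp only [Finset.sum_const, Finset.card_univ, Fintype.card_fin, smul_eq_mul, mul_one] at hsum
  exact ⟨x, hx, by omega⟩

end MinimaxIP

/-! ### Rounding minimax integer programs -/

namespace MinimaxIP

variable {m n : ℕ} (P : MinimaxIP m n)

theorem lpValue_nonneg (hm : 0 < m) : 0 ≤ P.lpValue := by
  refine Real.sInf_nonneg ?_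
  rintro W ⟨x, hx, -, hxW⟩
  refine le_trans ?_ (hxW ⟨0, hm⟩)
  rw [mulVec_apply_sum]
  exact Finset.sum_nonneg fun i _ => Finset.sum_nonneg fun j _ =>
    mul_nonneg (hx _).1 (P.A_mem _ _).1

open Classical in
theorem card_filter_le_columnSparsity (c : (i : Fin n) × Fin (P.ℓ i)) :
    (Finset.univ.filter fun r => P.A r c ≠ 0).card ≤ P.columnSparsity := by
  unfold columnSparsity
  exact Finset.le_sup (f := fun c => (Finset.univ.filter fun r => P.A r c ≠ 0).card)
    (Finset.mem_univ c)

/-- Discharges the degenerate case `a = 0` required by `exists_rounding_devH`, where `1 / a` is 0 by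
convention. -/
theorem lpValue_eq_zero_of_columnSparsity_eq_zero (hm : 0 < m) (hℓ : ∀ i, 0 < P.ℓ i)
    (h : P.columnSparsity = 0) : P.lpValue = 0 := by
  classical
  have hA : ∀ r c, P.A r c = 0 := by
    intro r c
    by_contra hne
    have h1 := P.card_filter_le_columnSparsity c
    rw [h, Nat.le_zero, Finset.card_eq_zero] at h1
    exact Finset.notMem_empty r (h1 ▸ Finset.mem_filter.2 ⟨Finset.mem_univ r, hne⟩)
  refine le_antisymm ?_ (P.lpValue_nonneg hm)
  obtain ⟨x, hx⟩ := P.exists_isFractionalSolution_lpValue hm hℓ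
  refine csInf_le ⟨0, ?_⟩ ⟨x, hx.1, hx.2.1, fun r => ?_⟩
  · rintro W ⟨z, hz, -, hzW⟩
    refine le_trans ?_ (hzW ⟨0, hm⟩)
    simp [mulVec_apply_sum, hA]
  · simp [mulVec_apply_sum, hA]

open Classical in
/-- Every minimax integer program has an integral solution close to the optimum of its linear
programming relaxation. -/
theorem exists_isIntegralSolution (hm : 0 < m) (hℓ : ∀ i, 0 < P.ℓ i) :
    ∃ x, P.IsIntegralSolution x (P.lpValue + (8 + 6 * (min P.lpValue (m : ℝ) *
      devH (min P.lpValue (m : ℝ)) (1 / (P.columnSparsity : ℝ))))) := by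
  obtain ⟨x, ⟨hx01, hxsum, hxW⟩, hxm⟩ := P.exists_isFractionalSolution_card_le
    (P.exists_isFractionalSolution_lpValue hm hℓ)
  have hx0 : ∀ c, 0 ≤ x c := fun c => (hx01 c).1
  let B : Finset (Fin n) := Finset.univ.filter fun i =>
    1 < (Finset.univ.filter fun j => x ⟨i, j⟩ ≠ 0).card
  -- Erasing the integral groups brings the row means down to at most `m`, since each of the at most
  -- `m` remaining groups contributes at most 1.
  let A' : Fin m → ∀ i, Fin (P.ℓ i) → ℝ := fun r i j => if i ∈ B then P.A r ⟨i, j⟩ else 0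
  have hA'le : ∀ r i j, A' r i j ≤ P.A r ⟨i, j⟩ := fun r i j => by
    simp only [A']; split_ifs
    · exact le_rfl
    · exact (P.A_mem _ _).1
  have hA' : ∀ r i j, A' r i j ∈ Set.Icc (0 : ℝ) 1 := fun r i j => by
    simp only [A']; split_ifs
    · exact P.A_mem _ _
    · simp
  have hsparse : ∀ i j, (Finset.univ.filter fun r => A' r i j ≠ 0).card ≤ P.columnSparsity := by
    intro i j
    refine le_trans (Finset.card_le_card fun r hr => ?_)
      (P.card_filter_le_columnSparsity ⟨i, j⟩)
    simp only [Finset.mem_filter, Finset.mem_univ, true_and] at hr ⊢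
    exact fun h0 => hr (by simp [A', h0])
  have hmean : ∀ r, ∑ i, ∑ j, x ⟨i, j⟩ * A' r i j ≤ min P.lpValue (m : ℝ) := by
    intro r
    refine le_min (le_trans ?_ (hxW r)) ?_
    · rw [mulVec_apply_sum]
      exact Finset.sum_le_sum fun i _ => Finset.sum_le_sum fun j _ =>
        mul_le_mul_of_nonneg_left (hA'le r i j) (hx0 _)
    · calc ∑ i, ∑ j, x ⟨i, j⟩ * A' r i j ≤ ∑ i, (if i ∈ B then (1 : ℝ) else 0) := by
            refine Finset.sum_le_sum fun i _ => ?_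
            by_cases hi : i ∈ B
            · rw [if_pos hi, ← hxsum i]
              exact Finset.sum_le_sum fun j _ => mul_le_of_le_one_right (hx0 _) (hA' r i j).2
            · simp [A', hi]
        _ = (B.card : ℝ) := by simp
        _ ≤ m := by exact_mod_cast hxm
  obtain ⟨f, hfpos, hf⟩ := exists_rounding_devH (p := fun i j => x ⟨i, j⟩) (fun i j => hx0 _)
    hxsum hA' hsparse (le_min (P.lpValue_nonneg hm) (Nat.cast_nonneg m)) (fun h0 => by
      rw [P.lpValue_eq_zero_of_columnSparsity_eq_zero hm hℓ h0]
      exact min_eq_left (Nat.cast_nonneg m)) hmean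
  -- The rounding picks only `j` with `x ⟨i, j⟩ > 0`, so it leaves integral groups unchanged and
  -- their contribution to each row is exact.
  have hfix : ∀ i ∉ B, ∀ j, x ⟨i, j⟩ = if j = f i then 1 else 0 := by
    intro i hi
    have hcard : (Finset.univ.filter fun j => x ⟨i, j⟩ ≠ 0).card ≤ 1 := by
      simpa [B] using hi
    have h0 : ∀ j, j ≠ f i → x ⟨i, j⟩ = 0 := by
      intro j hj
      by_contra hne
      exact hj (Finset.card_le_one.1 hcard j (by simpa using hne) (f i)
        (by simpa using (hfpos i).ne'))
    intro j
    split_ifs with hj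
    · rw [hj, ← hxsum i]
      exact (Finset.sum_eq_single (f i) (fun j _ hj => h0 j hj)
        fun h => absurd (Finset.mem_univ _) h).symm
    · exact h0 j hj
  refine ⟨fun c => if c.2 = f c.1 then 1 else 0, fun c => ?_, fun i => by simp, fun r => ?_⟩
  · dsimp only; split_ifs <;> simp
  · have hdiff : ∀ i, P.A r ⟨i, f i⟩ - A' r i (f i) =
        ∑ j, x ⟨i, j⟩ * P.A r ⟨i, j⟩ - ∑ j, x ⟨i, j⟩ * A' r i j := by
      intro i
      by_cases hi : i ∈ B
      · simp [A', hi]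
      · simp [A', hi, hfix i hi]
    have hsum := Finset.sum_congr (rfl : (Finset.univ : Finset (Fin n)) = _) fun i _ => hdiff i
    rw [Finset.sum_sub_distrib, Finset.sum_sub_distrib, ← mulVec_apply_sum] at hsum
    have hval : P.A.mulVec (fun c => if c.2 = f c.1 then 1 else 0) r = ∑ i, P.A r ⟨i, f i⟩ := by
      rw [mulVec_apply_sum]
      simp
    rw [hval]
    linarith [hf r, hxW r]

end MinimaxIP

/-! ### Set systems and the final constants -/

/-- Every set system has a colouring splitting all its sets evenly. -/
theorem exists_coloring_card_le {n M l : ℕ} (D : Fin M → Finset (Fin n)) (hl : 0 < l) {y : ℝ}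
    (hy : y = (setSystemMaxSize D : ℝ) / (l : ℝ)) :
    ∃ f : Fin n → Fin l, ∀ (j : Fin M) (k : Fin l),
      (((D j).filter fun i => f i = k).card : ℝ) ≤
        y + (8 + 6 * (y * devH y (1 / (setSystemDegree D : ℝ)))) := by
  classical
  have hl' : (0 : ℝ) < l := by exact_mod_cast hl
  -- One row per pair (set, colour). Column `(i, k)` meets only the rows `(j, k)` with `i ∈ D j`, so
  -- its sparsity is at most the degree, whatever the number of colours.
  let A : Fin M × Fin l → Fin n → Fin l → ℝ := fun r i k =>
    if i ∈ D r.1 ∧ k = r.2 then 1 else 0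
  have hmean : ∀ r, ∑ i, ∑ k, (1 / (l : ℝ)) * A r i k ≤ y := by
    intro r
    have h1 : ∀ i, ∑ k, (1 / (l : ℝ)) * A r i k = if i ∈ D r.1 then 1 / (l : ℝ) else 0 := by
      intro i
      by_cases hi : i ∈ D r.1 <;> simp [A, hi]
    simp only [h1]
    rw [← Finset.sum_filter, Finset.sum_const, Finset.filter_univ_mem, nsmul_eq_mul, hy,
      mul_one_div]
    gcongr
    exact Finset.le_sup (f := fun j => (D j).card) (Finset.mem_univ r.1)
  obtain ⟨f, -, hf⟩ := exists_rounding_devH (p := fun _ _ => 1 / (l : ℝ)) (A := A)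
    (a := setSystemDegree D) (μ := y) (fun _ _ => by positivity)
    (fun _ => by simp [hl'.ne'])
    (fun r i k => by simp only [A]; split_ifs <;> simp)
    (fun i k => by
      refine le_trans ?_ (Finset.le_sup
        (f := fun i => (Finset.univ.filter fun j => i ∈ D j).card) (Finset.mem_univ i))
      refine Finset.card_le_card_of_injOn Prod.fst (fun r hr => ?_) fun r hr s hs hrs => ?_
      · have : i ∈ D r.1 ∧ k = r.2 := by simpa [A] using hr
        simpa using this.1
      · have h1 : i ∈ D r.1 ∧ k = r.2 := by simpa [A] using hr
        have h2 : i ∈ D s.1 ∧ k = s.2 := by simpa [A] using hs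
        exact Prod.ext hrs (h1.2.symm.trans h2.2))
    (by rw [hy]; positivity)
    (fun h0 => by
      have hempty : ∀ j, D j = ∅ := fun j => Finset.eq_empty_of_forall_notMem fun i hi => by
        have h1 : (Finset.univ.filter fun j => i ∈ D j).card ≤ setSystemDegree D :=
          Finset.le_sup (f := fun i => (Finset.univ.filter fun j => i ∈ D j).card)
            (Finset.mem_univ i)
        rw [h0, Nat.le_zero, Finset.card_eq_zero] at h1
        exact Finset.notMem_empty j (h1 ▸ Finset.mem_filter.2 ⟨Finset.mem_univ j, hi⟩)
      have : setSystemMaxSize D = 0 := by simp [setSystemMaxSize, hempty]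
      rw [hy, this, Nat.cast_zero, zero_div])
    hmean
  refine ⟨f, fun j k => ?_⟩
  have h1 : ∑ i, A (j, k) i (f i) = (((D j).filter fun i => f i = k).card : ℝ) := by
    simp only [A, Finset.sum_boole]
    congr 2
    ext i
    simp
  rw [← h1]
  exact (hf (j, k)).trans (by gcongr; exact hmean _)

/-- Allows the coefficient 6 of the deviation term to be raised to 8, so that a single constant
serves as both additive and multiplicative `C`. -/
theorem mul_devH_nonneg {μ : ℝ} (hμ : 0 ≤ μ) (a : ℕ) : 0 ≤ μ * devH μ (1 / (a : ℝ)) := by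
  rcases hμ.eq_or_lt with rfl | hμ
  · rw [zero_mul]
  refine mul_nonneg hμ.le ?_
  rw [devH, one_div, inv_inv]
  split_ifs with h
  · have h1 : 1 ≤ Real.logb 2 a / μ := by rw [le_div_iff₀ hμ]; linarith
    exact div_nonneg (by linarith) (mul_nonneg hμ.le (Real.logb_nonneg one_lt_two h1))
  · exact Real.sqrt_nonneg _

theorem theorem4p5 :
    (∃ C : ℝ, 0 < C ∧
      ∀ (m n : ℕ) (P : MinimaxIP m n), 0 < m → (∀ i, 0 < P.ℓ i) →
        ∃ (x : ((i : Fin n) × Fin (P.ℓ i)) → ℝ) (W : ℝ), P.IsIntegralSolution x W ∧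
          W ≤ P.lpValue + C +
            C * (min P.lpValue (m : ℝ) *
              devH (min P.lpValue (m : ℝ)) (1 / (P.columnSparsity : ℝ)))) ∧
    (∃ C : ℝ, 0 < C ∧
      ∀ (n M l : ℕ) (D : Fin M → Finset (Fin n)) (y : ℝ), 0 < l →
        y = (setSystemMaxSize D : ℝ) / (l : ℝ) →
        ∃ f : Fin n → Fin l, ∀ (j : Fin M) (k : Fin l),
          (((D j).filter fun i => f i = k).card : ℝ) ≤
            y * (1 + C * devH y (1 / (setSystemDegree D : ℝ))) + C) := by
  refine ⟨⟨8, by norm_num, fun m n P hm hℓ => ?_⟩, ⟨8, by norm_num, fun n M l D y hl hy => ?_⟩⟩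
  · obtain ⟨x, hx⟩ := P.exists_isIntegralSolution hm hℓ
    refine ⟨x, _, hx, ?_⟩
    have := mul_devH_nonneg (le_min (P.lpValue_nonneg hm) (Nat.cast_nonneg m)) P.columnSparsity
    linarith
  · obtain ⟨f, hf⟩ := exists_coloring_card_le D hl hy
    refine ⟨f, fun j k => (hf j k).trans ?_⟩
    have := mul_devH_nonneg (show 0 ≤ y by rw [hy]; positivity) (setSystemDegree D)
    linarith
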